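/- A topological group $G$ is called \emph{amenable} if every continuous action $G\times X\to X$ of $G$ on a nonempty compact Hausdorff space $X$ has an invariant regular Borel probability measure, that is, a regular Borel probability measure $\mu$ on $X$ with $\mu(g^{-1}A)=\mu(A)$ for all $g\in G$ and all Borel sets $A\subseteq X$. Let $G$ be a Polish group (a topological group whose topology is separable and completely metrizable). Then $G$ is amenable if and only if every continuous action $G\times I^{\aleph_0}\to I^{\aleph_0}$ of $G$ on the Hilbert cube $I^{\aleph_0}=[0,1]^{\mathbb N}$ (with the product topology) has an invariant Borel probability measure. -/

import Mathlib

open MeasureTheory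

universe u v

/-- A topological group `G` is amenable if every (jointly) continuous action of `G` on a nonempty
compact Hausdorff space has an invariant regular Borel probability measure.
The universe of the compact spaces is independent of the universe of `G`. -/
def IsAmenableGroup (G : Type u) [Group G] [TopologicalSpace G] : Prop :=
  ∀ (X : Type v) [TopologicalSpace X] [CompactSpace X] [T2Space X] [Nonempty X]
    [MeasurableSpace X] [BorelSpace X] [MulAction G X] [ContinuousSMul G X],
    ∃ μ : Measure X, IsProbabilityMeasure μ ∧ μ.Regular ∧ SMulInvariantMeasure G X μ

/-- The Hilbert cube: the countably infinite power of `[0, 1]` with the product topology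
(and the product σ-algebra, which is its Borel σ-algebra). -/
abbrev HilbertCube : Type := ℕ → unitInterval

/-!
The Hilbert cube is itself a compact space, so an amenable group has invariant measures for all of
its actions on it. The content is the converse: invariant measures on Hilbert cubes produce
invariant measures on every compact Hausdorff `G`-space `X`.

By compactness of the state space of `C(X, ℝ)` and the Riesz representation theorem it suffices to
find, for finitely many functions `v` and group elements `g`, a state `φ` with `φ (v ∘ g) = φ v`.
After replacing `X` by `X × [0, 1]`, the space of continuous functions is infinite-dimensional, and,
`G` being separable, the translates of the finitely many functions lie in the closed span of the
constants and of a sequence `f` that is linearly independent modulo constants, with `G`-invariant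
span closure (`exists_seq_forall_comp_smulMap_mem_closure`). The set `K ⊆ ℝ^ℕ` of moment sequences
`(φ (f i))ᵢ` of states is compact and convex, `G` acts on it continuously by affine maps, and all its
finite-dimensional projections have interior points. By Keller's theorem
(`nonempty_homeomorph_hilbertCube`) `K` is a Hilbert cube, so it carries an invariant probability
measure. Averaging the finitely many affine functions `φ ↦ φ (v ∘ g) - φ v` over it gives zero, and
the average of a map into a compact convex set is one of its values
(`exists_state_forall_mem_finset`).

Keller's theorem is proved by approximating the coordinate projections `K_{m+1} → K_m` by
homeomorphisms `K_{m+1} ≃ K_m × [0, 1]` (`exists_homeomorph_prod_unitInterval`): a radial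
contraction of the convex body `K_{m+1}` pushes it away from its degenerate fibres over `K_m`, after
which all fibres are segments with continuously varying endpoints. Composing these gives
homeomorphisms of the `K_m` onto finite-dimensional cubes which commute with the projections up to
`2^{-m}`; they and their inverses converge to a homeomorphism of `K` onto the cube.
-/

open Set Filter Topology
open scoped unitInterval Pointwise

/-! ### Convex bodies over their projections -/

/-- The lower boundary of a compact convex set over its projection is a convex function. -/
lemma exists_convexOn_isLeast_fiber {E : Type*} [NormedAddCommGroup E] [NormedSpace ℝ E]
    {C : Set (E × ℝ)} (hC : IsCompact C) (hconv : Convex ℝ C) :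
    ∃ a : E → ℝ, ConvexOn ℝ (Prod.fst '' C) a ∧
      ∀ x ∈ Prod.fst '' C, IsLeast {t | (x, t) ∈ C} (a x) := by
  have key : ∀ x ∈ Prod.fst '' C, IsLeast {t | (x, t) ∈ C} (sInf {t | (x, t) ∈ C}) := by
    rintro x ⟨⟨x', t⟩, hp, rfl⟩
    have hcomp : IsCompact {t | (x', t) ∈ C} := by
      have : {t | (x', t) ∈ C} = Prod.snd '' (C ∩ Prod.fst ⁻¹' {x'}) := by
        ext s
        constructor
        · intro hs
          exact ⟨(x', s), ⟨hs, rfl⟩, rfl⟩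
        · rintro ⟨⟨y, s'⟩, ⟨h1, h2⟩, rfl⟩
          obtain rfl : y = x' := h2
          exact h1
      rw [this]
      exact (hC.inter_right (isClosed_singleton.preimage continuous_fst)).image continuous_snd
    exact hcomp.isLeast_sInf ⟨t, hp⟩
  refine ⟨fun x => sInf {t | (x, t) ∈ C}, ⟨hconv.linear_image (LinearMap.fst ℝ E ℝ), ?_⟩, key⟩
  intro x hx y hy s t hs ht hst
  have h := hconv (key x hx).1 (key y hy).1 hs ht hst
  have h' : (s • x + t • y, s • sInf {r | (x, r) ∈ C} + t • sInf {r | (y, r) ∈ C}) ∈ C := h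
  exact (key _ ⟨_, h', rfl⟩).2 h'

/-- The upper boundary of a compact convex set over its projection is a concave function, by
reflection of `exists_convexOn_isLeast_fiber`. -/
lemma exists_concaveOn_isGreatest_fiber {E : Type*} [NormedAddCommGroup E] [NormedSpace ℝ E]
    {C : Set (E × ℝ)} (hC : IsCompact C) (hconv : Convex ℝ C) :
    ∃ b : E → ℝ, ConcaveOn ℝ (Prod.fst '' C) b ∧
      ∀ x ∈ Prod.fst '' C, IsGreatest {t | (x, t) ∈ C} (b x) := by
  let r : E × ℝ →ₗ[ℝ] E × ℝ := (LinearMap.fst ℝ E ℝ).prod (-LinearMap.snd ℝ E ℝ)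
  have hr : ∀ p : E × ℝ, r p = (p.1, -p.2) := fun p => rfl
  have hrc : Continuous r := by
    have : (r : E × ℝ → E × ℝ) = fun p => (p.1, -p.2) := funext hr
    rw [this]; fun_prop
  have hmem : ∀ x t, (x, t) ∈ r '' C ↔ (x, -t) ∈ C := by
    intro x t
    constructor
    · rintro ⟨⟨y, s⟩, hp, h⟩
      rw [hr, Prod.mk.injEq] at h
      obtain ⟨rfl, rfl⟩ := h
      simpa using hp
    · intro h
      exact ⟨_, h, by simp [hr]⟩
  have hfst : Prod.fst '' (r '' C) = Prod.fst '' C := by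
    rw [image_image]; rfl
  obtain ⟨a, ha, hl⟩ := exists_convexOn_isLeast_fiber (hC.image hrc) (hconv.linear_image r)
  rw [hfst] at ha hl
  refine ⟨fun x => -a x, ha.neg, fun x hx => ⟨(hmem _ _).1 (hl x hx).1, fun t ht => ?_⟩⟩
  have := (hl x hx).2 (show -t ∈ {t | (x, t) ∈ r '' C} from (hmem _ _).2 (by simpa using ht))
  linarith

/-- Over a set `S` of base points whose fibres are non-degenerate segments, a compact convex subset
of `E × ℝ` is a product `S × [0, 1]`: the endpoints of the fibres depend continuously on the base
point, being convex and concave functions on the interior of the projection. -/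
lemma exists_homeomorph_prod_unitInterval_of_fiber {E : Type*} [NormedAddCommGroup E]
    [NormedSpace ℝ E] [FiniteDimensional ℝ E] {C : Set (E × ℝ)} (hC : IsCompact C)
    (hconv : Convex ℝ C) {S : Set E} (hS : S ⊆ interior (Prod.fst '' C))
    (hfib : ∀ x ∈ S, ∃ t t', t < t' ∧ (x, t) ∈ C ∧ (x, t') ∈ C) :
    ∃ h : {p : E × ℝ // p ∈ C ∧ p.1 ∈ S} ≃ₜ S × I, ∀ p, ((h p).1 : E) = p.1.1 := by
  obtain ⟨a, hac, ha⟩ := exists_convexOn_isLeast_fiber hC hconv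
  obtain ⟨b, hbc, hb⟩ := exists_concaveOn_isGreatest_fiber hC hconv
  have hSD : ∀ x ∈ S, x ∈ Prod.fst '' C := fun x hx => interior_subset (hS hx)
  have haS : Continuous fun x : S => a x :=
    continuousOn_iff_continuous_domRestrict.1 (hac.continuousOn_interior.mono hS)
  have hbS : Continuous fun x : S => b x :=
    continuousOn_iff_continuous_domRestrict.1 (hbc.continuousOn_interior.mono hS)
  have hab : ∀ x ∈ S, 0 < b x - a x := by
    intro x hx
    obtain ⟨t, t', htt, ht, ht'⟩ := hfib x hx
    have h1 := (ha x (hSD x hx)).2 ht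
    have h2 := (hb x (hSD x hx)).2 ht'
    linarith
  have hmem : ∀ x ∈ S, ∀ s ∈ I, (x, a x + s * (b x - a x)) ∈ C := by
    intro x hx s hs
    have h := hconv (ha x (hSD x hx)).1 (hb x (hSD x hx)).1 (sub_nonneg.2 hs.2) hs.1 (by ring)
    convert h using 1
    ext
    · simp [← add_smul]
    · simp; ring
  let P := {p : E × ℝ // p ∈ C ∧ p.1 ∈ S}
  have haP : Continuous fun p : P => a p.1.1 :=
    haS.comp (show Continuous fun p : P => (⟨p.1.1, p.2.2⟩ : S) by fun_prop)
  have hbP : Continuous fun p : P => b p.1.1 :=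
    hbS.comp (show Continuous fun p : P => (⟨p.1.1, p.2.2⟩ : S) by fun_prop)
  refine ⟨{ toFun := fun p => (⟨p.1.1, p.2.2⟩,
              ⟨(p.1.2 - a p.1.1) / (b p.1.1 - a p.1.1), ?_, ?_⟩)
            invFun := fun q => ⟨(q.1, a q.1 + q.2 * (b q.1 - a q.1)),
              hmem q.1 q.1.2 q.2 q.2.2, q.1.2⟩
            left_inv := ?_
            right_inv := ?_
            continuous_toFun := ?_
            continuous_invFun := ?_ }, fun p => rfl⟩
  · exact div_nonneg (sub_nonneg.2 ((ha _ (hSD _ p.2.2)).2 p.2.1)) (hab _ p.2.2).le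
  · rw [div_le_one (hab _ p.2.2)]
    have := (hb _ (hSD _ p.2.2)).2 (show p.1.2 ∈ {t | (p.1.1, t) ∈ C} from p.2.1)
    linarith
  · rintro ⟨⟨x, t⟩, hp, hx⟩
    have := (hab x hx).ne'
    ext
    · rfl
    · simp only
      field_simp
      ring
  · rintro ⟨⟨x, hx⟩, s, hs⟩
    have := (hab x hx).ne'
    ext
    · rfl
    · simp only
      field_simp
      ring
  · refine Continuous.prodMk (by fun_prop) (Continuous.subtype_mk ?_ _)
    exact ((continuous_snd.comp continuous_subtype_val).sub haP).div (hbP.sub haP)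
      fun p => (hab _ p.2.2).ne'
  · refine Continuous.subtype_mk (Continuous.prodMk (by fun_prop) ?_) _
    exact (haS.comp continuous_fst).add ((continuous_subtype_val.comp continuous_snd).mul
      ((hbS.comp continuous_fst).sub (haS.comp continuous_fst)))

/-- Shrinking a convex body radially makes it small enough to avoid degenerate fibres, so that
`exists_homeomorph_prod_unitInterval_of_fiber` applies, at the price of moving base points by at
most `δ`. -/
lemma exists_homeomorph_prod_unitInterval_of_mem_nhds {E : Type*} [NormedAddCommGroup E]
    [NormedSpace ℝ E] [FiniteDimensional ℝ E] {C : Set (E × ℝ)} (hC : IsCompact C)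
    (hconv : Convex ℝ C) (h0 : C ∈ 𝓝 0) {δ : ℝ} (hδ : 0 < δ) :
    ∃ h : C ≃ₜ (Prod.fst '' C) × I, ∀ c : C, dist ((h c).1 : E) c.1.1 ≤ δ := by
  obtain ⟨R, hR0, hR⟩ := hC.isBounded.exists_pos_norm_le
  -- the base points are contracted by a factor between `l⁻¹` and `1`, then dilated by `l`; with
  -- norms at most `R` the total displacement is at most `(l - 1) * R = δ`
  set l : ℝ := 1 + δ / R with hl
  have hl1 : 1 < l := by rw [hl]; linarith [div_pos hδ hR0]
  have hl0 : 0 < l := by linarith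
  have hli : l⁻¹ < 1 := inv_lt_one_of_one_lt₀ hl1
  have hli0 : 0 < l⁻¹ := inv_pos.2 hl0
  set D := Prod.fst '' C with hD
  have hDconv : Convex ℝ D := hconv.linear_image (LinearMap.fst ℝ E ℝ)
  have hD0 : D ∈ 𝓝 0 := by
    have := isOpenMap_fst.image_mem_nhds (x := (0 : E × ℝ)) h0
    exact this
  have hDcomp : IsCompact D := hC.image continuous_fst
  let S : Set E := {x | l • x ∈ D}
  let L : Set (E × ℝ) := {p | p ∈ C ∧ p.1 ∈ S}
  have hscale : ∀ p ∈ C, l⁻¹ • p ∈ L := by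
    intro p hp
    refine ⟨hconv.smul_mem_of_zero_mem (mem_of_mem_nhds h0) hp ⟨hli0.le, hli.le⟩, ?_⟩
    change l • (l⁻¹ • p.1) ∈ D
    rw [smul_smul, mul_inv_cancel₀ hl0.ne', one_smul]
    exact ⟨p, hp, rfl⟩
  have hLC : L ⊆ C := fun p hp => hp.1
  have hLconv : Convex ℝ L := by
    refine hconv.inter ?_
    exact (hDconv.linear_preimage (l • LinearMap.id)).linear_preimage (LinearMap.fst ℝ E ℝ)
  have hL0 : L ∈ 𝓝 0 := by
    have h1 : l⁻¹ • C ∈ 𝓝 (0 : E × ℝ) := (set_smul_mem_nhds_zero_iff hli0.ne').2 h0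
    refine mem_of_superset h1 ?_
    rintro _ ⟨p, hp, rfl⟩
    exact hscale p hp
  have hLclosed : IsClosed L :=
    hC.isClosed.inter (hDcomp.isClosed.preimage
      ((continuous_const_smul l).comp continuous_fst))
  have hCb : Bornology.IsVonNBounded ℝ C := NormedSpace.isVonNBounded_of_isBounded _ hC.isBounded
  have hLb : Bornology.IsVonNBounded ℝ L := hCb.subset hLC
  -- the radial homeomorphism of `C` onto its part `L` over `l⁻¹ • D`
  let T := gaugeRescaleHomeomorph C L hconv h0 hCb hLconv hL0 hLb
  have hTim : T '' C = L := by
    have := image_gaugeRescaleHomeomorph_closure hconv h0 hCb hLconv hL0 hLb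
    rwa [hC.isClosed.closure_eq, hLclosed.closure_eq] at this
  -- every `x ∈ S` is `l⁻¹ • d` with `d ∈ D`, hence the centre of a scaled copy of a neighbourhood
  have hSint : S ⊆ interior D := by
    intro x hx
    have hx' : x = l⁻¹ • (l • x) := by rw [smul_smul, inv_mul_cancel₀ hl0.ne', one_smul]
    have := hDconv.combo_self_interior_mem_interior hx (mem_interior_iff_mem_nhds.2 hD0)
      hli0.le (sub_pos.2 hli) (by ring)
    rw [smul_zero, add_zero, ← hx'] at this
    exact this
  have hfib : ∀ x ∈ S, ∃ t t', t < t' ∧ (x, t) ∈ C ∧ (x, t') ∈ C := by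
    rintro x ⟨p, hp, hpx⟩
    have hx' : x = l⁻¹ • p.1 := by rw [hpx, smul_smul, inv_mul_cancel₀ hl0.ne', one_smul]
    have hcont : Tendsto (fun s : ℝ => ((0 : E), s)) (𝓝 0) (𝓝 0) := by
      have : Continuous fun s : ℝ => ((0 : E), s) := by fun_prop
      exact this.tendsto 0
    obtain ⟨r, hr0, hr⟩ := Metric.mem_nhds_iff.1 (hcont h0)
    have hr' : ((0 : E), r / 2) ∈ C := hr (by
      rw [Metric.mem_ball, Real.dist_eq, sub_zero, abs_of_pos (by positivity)]; linarith)
    have hz : ((0 : E), (0 : ℝ)) ∈ C := mem_of_mem_nhds h0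
    have h1 := hconv hp hz hli0.le (sub_pos.2 hli).le (by ring)
    have h2 := hconv hp hr' hli0.le (sub_pos.2 hli).le (by ring)
    refine ⟨l⁻¹ * p.2, l⁻¹ * p.2 + (1 - l⁻¹) * (r / 2), ?_, ?_, ?_⟩
    · have := mul_pos (sub_pos.2 hli) (half_pos hr0)
      linarith
    · convert h1 using 1
      ext <;> simp [hx']
    · convert h2 using 1
      ext <;> simp [hx']
  obtain ⟨f, hf⟩ := exists_homeomorph_prod_unitInterval_of_fiber hC hconv hSint hfib
  let e1 : C ≃ₜ L := T.subtype (p := (· ∈ C)) (q := (· ∈ L)) fun x => by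
    rw [← hTim]; exact (T.injective.mem_set_image).symm
  let e2 : S ≃ₜ D := (Homeomorph.smulOfNeZero l hl0.ne').subtype
    (p := (· ∈ S)) (q := (· ∈ D)) fun x => Iff.rfl
  refine ⟨(e1.trans f).trans (e2.prodCongr (Homeomorph.refl I)), fun c => ?_⟩
  have hval : (((e1.trans f).trans (e2.prodCongr (Homeomorph.refl I)) c).1 : E)
      = l • (gaugeRescale C L c.1).1 := by
    change l • ((f (e1 c)).1 : E) = _
    rw [hf]; rfl
  rw [hval, dist_eq_norm]
  by_cases hc : c.1 = 0
  · simp [hc, hδ.le]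
  have hgL : 0 < gauge L c.1 := (gauge_pos (absorbent_nhds_zero hL0) hLb).2 hc
  have hle1 : gauge C c.1 ≤ gauge L c.1 := gauge_mono (absorbent_nhds_zero hL0) hLC c.1
  have hle2 : gauge L c.1 ≤ l * gauge C c.1 := by
    have habs : Absorbent ℝ (l⁻¹ • C) :=
      absorbent_nhds_zero ((set_smul_mem_nhds_zero_iff hli0.ne').2 h0)
    have := gauge_mono habs (t := L) (by rintro _ ⟨p, hp, rfl⟩; exact hscale p hp) c.1
    rwa [gauge_smul_left_of_nonneg hli0.le, inv_inv, Pi.smul_apply, smul_eq_mul] at this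
  set r := gauge C c.1 / gauge L c.1 with hr
  have hr1 : r ≤ 1 := (div_le_one hgL).2 hle1
  have hr2 : 1 ≤ l * r := by
    rw [hr, mul_div_assoc', le_div_iff₀ hgL]; linarith
  have hcalc : l • (gaugeRescale C L c.1).1 - c.1.1 = (l * r - 1) • c.1.1 := by
    rw [gaugeRescale_def, Prod.smul_fst, smul_smul, sub_smul, one_smul]
  rw [hcalc, norm_smul, Real.norm_eq_abs, abs_of_nonneg (by linarith)]
  calc (l * r - 1) * ‖c.1.1‖ ≤ (l - 1) * R := by
        refine mul_le_mul ?_ ((norm_fst_le c.1).trans (hR _ c.2)) (norm_nonneg _) (by linarith)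
        nlinarith
    _ = δ := by rw [hl]; field_simp; ring

/-- A convex body in `E × ℝ` is homeomorphic to the product of its projection to `E` and `[0, 1]`,
by a homeomorphism that is as close as desired to the identity in the `E`-direction. -/
lemma exists_homeomorph_prod_unitInterval {E : Type*} [NormedAddCommGroup E]
    [NormedSpace ℝ E] [FiniteDimensional ℝ E] {C : Set (E × ℝ)} (hC : IsCompact C)
    (hconv : Convex ℝ C) (hint : (interior C).Nonempty) {δ : ℝ} (hδ : 0 < δ) :
    ∃ h : C ≃ₜ (Prod.fst '' C) × I, ∀ c : C, dist ((h c).1 : E) c.1.1 ≤ δ := by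
  obtain ⟨p, hp⟩ := hint
  let τ : E × ℝ ≃ₜ E × ℝ := Homeomorph.addRight p
  let ρ : E ≃ₜ E := Homeomorph.addRight p.1
  let C' : Set (E × ℝ) := τ ⁻¹' C
  have h0 : C' ∈ 𝓝 0 := by
    refine τ.continuous.continuousAt.preimage_mem_nhds ?_
    simpa [τ] using mem_interior_iff_mem_nhds.1 hp
  have hconv' : Convex ℝ C' := hconv.translate_preimage_left p
  have hC' : IsCompact C' := τ.isCompact_preimage.2 hC
  obtain ⟨h, hh⟩ := exists_homeomorph_prod_unitInterval_of_mem_nhds hC' hconv' h0 hδ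
  let e1 : C' ≃ₜ C := τ.subtype (p := (· ∈ C')) (q := (· ∈ C)) fun x => Iff.rfl
  let e2 : (Prod.fst '' C' : Set E) ≃ₜ (Prod.fst '' C : Set E) :=
    ρ.subtype (p := (· ∈ Prod.fst '' C')) (q := (· ∈ Prod.fst '' C)) fun x => by
      constructor
      · rintro ⟨q, hq, rfl⟩
        exact ⟨q + p, hq, rfl⟩
      · rintro ⟨q, hq, hqx⟩
        refine ⟨q - p, ?_, ?_⟩
        · change q - p + p ∈ C
          simpa using hq
        · change q.1 - p.1 = x
          rw [hqx]; simp [ρ]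
  refine ⟨(e1.symm.trans h).trans (e2.prodCongr (Homeomorph.refl I)), fun c => ?_⟩
  obtain ⟨c, rfl⟩ := e1.surjective c
  have h1 : (((e1.symm.trans h).trans (e2.prodCongr (Homeomorph.refl I)) (e1 c)).1 : E)
      = ((h c).1 : E) + p.1 := by
    change ((h (e1.symm (e1 c))).1 : E) + p.1 = _
    rw [e1.symm_apply_apply]
  have h2 : (e1 c).1.1 = c.1.1 + p.1 := rfl
  rw [h1, h2, dist_add_right]
  exact hh c

/-! ### Keller's theorem -/

/-- Appending a last coordinate, as a homeomorphism. -/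
def snocHomeomorph (α : Type*) [TopologicalSpace α] (m : ℕ) :
    (Fin m → α) × α ≃ₜ (Fin (m + 1) → α) where
  toFun p := Fin.snoc (α := fun _ => α) p.1 p.2
  invFun x := (Fin.init x, x (Fin.last m))
  left_inv p := by simp
  right_inv x := by simp
  continuous_toFun := by
    refine continuous_pi fun i => ?_
    refine Fin.lastCases ?_ (fun i => ?_) i
    · simpa using continuous_snd
    · simp only [Fin.snoc_castSucc]; fun_prop
  continuous_invFun := by
    refine Continuous.prodMk (continuous_pi fun i => ?_) (continuous_apply _)
    exact continuous_apply (Fin.castSucc i)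

/-- The restriction of a sequence to its first `m` coordinates. -/
def initialSegment {α : Type*} (m : ℕ) (k : ℕ → α) : Fin m → α := fun i => k i

lemma continuous_initialSegment {α : Type*} [TopologicalSpace α] (m : ℕ) :
    Continuous (initialSegment (α := α) m) :=
  continuous_pi fun i => continuous_apply (i : ℕ)

lemma init_mem_image_initialSegment {K : Set (ℕ → ℝ)} {m : ℕ}
    (y : initialSegment (m + 1) '' K) : Fin.init y.1 ∈ initialSegment m '' K := by
  obtain ⟨_, k, hk, rfl⟩ := y
  exact ⟨k, hk, rfl⟩

/-- Homeomorphisms of the finite-dimensional projections of `K` onto cubes can be chosen to commute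
up to `δ` with forgetting the last coordinate. -/
lemma exists_homeomorph_succ {K : Set (ℕ → ℝ)} (hK : IsCompact K) (hconv : Convex ℝ K) (m : ℕ)
    (hint : (interior (initialSegment (m + 1) '' K)).Nonempty)
    (H : initialSegment m '' K ≃ₜ (Fin m → I)) {δ : ℝ} (hδ : 0 < δ) :
    ∃ H' : initialSegment (m + 1) '' K ≃ₜ (Fin (m + 1) → I), ∀ y : initialSegment (m + 1) '' K,
      (∀ i : Fin m,
        |(H' y i.castSucc : ℝ) - H ⟨Fin.init y.1, init_mem_image_initialSegment y⟩ i| ≤ δ) ∧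
      ∀ i : Fin m, |(H.symm (Fin.init (H' y))).1 i - y.1 i.castSucc| ≤ δ := by
  have hAm : IsCompact (initialSegment m '' K) := hK.image (continuous_initialSegment m)
  have hAm' : IsCompact (initialSegment (m + 1) '' K) :=
    hK.image (continuous_initialSegment (m + 1))
  have : CompactSpace (initialSegment m '' K) := isCompact_iff_compactSpace.1 hAm
  -- base points that are `ε`-close have `δ`-close images under `H`
  obtain ⟨ε, hε, hH⟩ := Metric.uniformContinuous_iff.1
    (CompactSpace.uniformContinuous_of_continuous H.continuous) δ hδ
  let e : (Fin (m + 1) → ℝ) ≃ₜ (Fin m → ℝ) × ℝ := (snocHomeomorph ℝ m).symm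
  let ℓ : (Fin (m + 1) → ℝ) →ₗ[ℝ] (Fin m → ℝ) × ℝ :=
    (LinearMap.funLeft ℝ ℝ Fin.castSucc).prod (LinearMap.proj (Fin.last m))
  let C := e '' (initialSegment (m + 1) '' K)
  have hC : IsCompact C := hAm'.image e.continuous
  have hAconv : Convex ℝ (initialSegment (m + 1) '' K) :=
    hconv.linear_image (LinearMap.funLeft ℝ ℝ (fun i : Fin (m + 1) => (i : ℕ)))
  have hCconv : Convex ℝ C := hAconv.linear_image ℓ
  have hCint : (interior C).Nonempty := by
    rw [← e.image_interior]; exact hint.image _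
  have hfst : Prod.fst '' C = initialSegment m '' K := by
    simp only [C, image_image]
    rfl
  obtain ⟨h, hh⟩ := exists_homeomorph_prod_unitInterval hC hCconv hCint
    (lt_min hδ (half_pos hε))
  let e1 : initialSegment (m + 1) '' K ≃ₜ C := e.image _
  let e2 : (Prod.fst '' C : Set (Fin m → ℝ)) ≃ₜ (initialSegment m '' K : Set (Fin m → ℝ)) :=
    Homeomorph.setCongr hfst
  let H' := ((e1.trans h).trans ((e2.trans H).prodCongr (Homeomorph.refl I))).trans
    (snocHomeomorph I m)
  refine ⟨H', fun y => ?_⟩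
  have hinit : Fin.init (H' y) = H (e2 (h (e1 y)).1) := by
    change Fin.init (Fin.snoc (α := fun _ => I) (H (e2 (h (e1 y)).1)) _) = _
    rw [Fin.init_snoc]
  have hclose : dist (e2 (h (e1 y)).1) ⟨Fin.init y.1, init_mem_image_initialSegment y⟩
      ≤ min δ (ε / 2) := hh (e1 y)
  refine ⟨fun i => ?_, fun i => ?_⟩
  · have h1 := hH (lt_of_le_of_lt (hclose.trans (min_le_right _ _)) (half_lt_self hε))
    rw [← hinit] at h1
    exact (dist_le_pi_dist _ _ i).trans h1.le
  · rw [hinit, H.symm_apply_apply]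
    exact (dist_le_pi_dist (e2 (h (e1 y)).1).1 (Fin.init y.1) i).trans
      (hclose.trans (min_le_left _ _))

lemma exists_tendsto_of_abs_sub_le_geometric {X : Type*} [TopologicalSpace X] [CompactSpace X]
    (f : ℕ → C(X, ℝ)) (N : ℕ) (h : ∀ n, N ≤ n → ∀ x, |f n x - f (n + 1) x| ≤ (1 / 2) ^ n) :
    ∃ F : C(X, ℝ), Tendsto f atTop (𝓝 F) := by
  have hc : CauchySeq fun n => f (n + N) := by
    refine cauchySeq_of_le_geometric (1 / 2) 1 (by norm_num) fun n => ?_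
    rw [one_mul, ContinuousMap.dist_le (by positivity)]
    intro x
    rw [show n + 1 + N = n + N + 1 by omega]
    exact (h (n + N) (Nat.le_add_left _ _) x).trans
      (pow_le_pow_of_le_one (by norm_num) (by norm_num) (Nat.le_add_right _ _))
  obtain ⟨F, hF⟩ := cauchySeq_tendsto_of_complete hc
  exact ⟨F, (tendsto_add_atTop_iff_nat N).1 hF⟩

/-- The extension of a finite sequence by zeros. -/
def extendZero {α : Type*} [Zero α] {m : ℕ} (x : Fin m → α) : ℕ → α :=
  fun i => if h : i < m then x ⟨i, h⟩ else 0

lemma extendZero_of_lt {α : Type*} [Zero α] {m : ℕ} (x : Fin m → α) {i : ℕ} (h : i < m) :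
    extendZero x i = x ⟨i, h⟩ := dif_pos h

lemma initialSegment_extendZero {α : Type*} [Zero α] {m : ℕ} (x : Fin m → α) :
    initialSegment m (extendZero x) = x :=
  funext fun i => extendZero_of_lt x i.2

lemma continuous_extendZero {α : Type*} [Zero α] [TopologicalSpace α] {m : ℕ} :
    Continuous (extendZero (α := α) (m := m)) := by
  refine continuous_pi fun i => ?_
  unfold extendZero
  split_ifs with h
  · exact continuous_apply (⟨i, h⟩ : Fin m)
  · exact continuous_const

/-- **Keller's theorem**: a compact convex set of real sequences whose finite-dimensional
coordinate projections all have interior points is homeomorphic to the Hilbert cube. -/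
theorem nonempty_homeomorph_hilbertCube {K : Set (ℕ → ℝ)} (hK : IsCompact K)
    (hconv : Convex ℝ K) (hint : ∀ m, (interior (initialSegment m '' K)).Nonempty) :
    Nonempty (K ≃ₜ HilbertCube) := by
  have : CompactSpace K := isCompact_iff_compactSpace.1 hK
  have : Unique (initialSegment 0 '' K) :=
    uniqueOfSubsingleton ⟨_, interior_subset (hint 0).some_mem⟩
  have H0 : initialSegment 0 '' K ≃ₜ (Fin 0 → I) := Homeomorph.homeomorphOfUnique _ _
  choose step hstep using fun m H =>
    exists_homeomorph_succ hK hconv m (hint (m + 1)) H (δ := (1 / 2) ^ m) (by positivity)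
  let H : ∀ m, initialSegment m '' K ≃ₜ (Fin m → I) :=
    fun m => Nat.rec H0 (fun m Hm => step m Hm) m
  have hH : ∀ m (y : initialSegment (m + 1) '' K),
      (∀ i : Fin m, |(H (m + 1) y i.castSucc : ℝ)
        - H m ⟨Fin.init y.1, init_mem_image_initialSegment y⟩ i| ≤ (1 / 2) ^ m) ∧
      ∀ i : Fin m, |((H m).symm (Fin.init (H (m + 1) y))).1 i - y.1 i.castSucc| ≤ (1 / 2) ^ m :=
    fun m y => hstep m (H m) y
  let p : ∀ m, K → initialSegment m '' K := fun m k => ⟨initialSegment m k.1, k.1, k.2, rfl⟩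
  have hp : ∀ m, Continuous (p m) := fun m =>
    ((continuous_initialSegment m).comp continuous_subtype_val).subtype_mk _
  -- the approximations to the homeomorphism and to its inverse, coordinate by coordinate
  let s : ∀ m, K → HilbertCube := fun m k => extendZero (H m (p m k))
  have hs : ∀ m, Continuous (s m) := fun m =>
    continuous_extendZero.comp ((H m).continuous.comp (hp m))
  let t : ∀ m, HilbertCube → ℕ → ℝ := fun m q => extendZero ((H m).symm (initialSegment m q)).1
  have ht : ∀ m, Continuous (t m) := fun m => continuous_extendZero.comp
    (continuous_subtype_val.comp ((H m).symm.continuous.comp (continuous_initialSegment m)))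
  have hts : ∀ m k j, j < m → t m (s m k) j = k.1 j := by
    intro m k j hj
    simp only [t, s, initialSegment_extendZero, Homeomorph.symm_apply_apply]
    rw [extendZero_of_lt _ hj]; rfl
  let ψ : ℕ → ℕ → C(K, ℝ) := fun i m =>
    ⟨fun k => s m k i, continuous_subtype_val.comp ((continuous_apply i).comp (hs m))⟩
  let φ : ℕ → ℕ → C(HilbertCube, ℝ) := fun j m =>
    ⟨fun q => t m q j, (continuous_apply j).comp (ht m)⟩
  have hψ : ∀ i, ∃ F, Tendsto (ψ i) atTop (𝓝 F) := fun i =>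
    exists_tendsto_of_abs_sub_le_geometric _ (i + 1) fun m hm k => by
      rw [abs_sub_comm]
      change |((extendZero (H (m + 1) (p (m + 1) k)) i : I) : ℝ) - (extendZero (H m (p m k)) i : I)| ≤ _
      rw [extendZero_of_lt _ (show i < m by omega), extendZero_of_lt _ (show i < m + 1 by omega)]
      exact (hH m (p (m + 1) k)).1 ⟨i, by omega⟩
  have hφ : ∀ j, ∃ F, Tendsto (φ j) atTop (𝓝 F) := fun j =>
    exists_tendsto_of_abs_sub_le_geometric _ (j + 1) fun m hm q => by
      change |extendZero ((H m).symm (initialSegment m q)).1 j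
        - extendZero ((H (m + 1)).symm (initialSegment (m + 1) q)).1 j| ≤ _
      rw [extendZero_of_lt _ (show j < m by omega), extendZero_of_lt _ (show j < m + 1 by omega)]
      have := (hH m ((H (m + 1)).symm (initialSegment (m + 1) q))).2 ⟨j, by omega⟩
      rw [Homeomorph.apply_symm_apply] at this
      exact this
  choose Ψ hΨ using hψ
  choose Φ hΦ using hφ
  have hΨk : ∀ i k, Tendsto (fun m => (s m k i : ℝ)) atTop (𝓝 (Ψ i k)) := fun i k =>
    ((continuous_eval_const k).tendsto _).comp (hΨ i)
  have hΨI : ∀ i k, Ψ i k ∈ I := fun i k =>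
    isClosed_Icc.mem_of_tendsto (hΨk i k) (Eventually.of_forall fun m => (s m k i).2)
  let Θ : K → HilbertCube := fun k i => ⟨Ψ i k, hΨI i k⟩
  have hΘ : Continuous Θ := continuous_pi fun i => (Ψ i).continuous.subtype_mk _
  have hsΘ : ∀ k, Tendsto (fun m => s m k) atTop (𝓝 (Θ k)) := fun k =>
    tendsto_pi_nhds.2 fun i => tendsto_subtype_rng.2 (hΨk i k)
  -- `Φ ∘ Θ = id`, since the `φ j m` converge uniformly
  have hΦΘ : ∀ k j, Φ j (Θ k) = k.1 j := by
    intro k j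
    have h1 : Tendsto (fun m => φ j m (s m k)) atTop (𝓝 (Φ j (Θ k))) :=
      (continuous_eval.tendsto (Φ j, Θ k)).comp ((hΦ j).prodMk_nhds (hsΘ k))
    refine tendsto_nhds_unique h1 (tendsto_const_nhds.congr' ?_)
    filter_upwards [eventually_gt_atTop j] with m hm
    exact (hts m k j hm).symm
  have hinj : Function.Injective Θ := fun k k' h =>
    Subtype.ext (funext fun j => by rw [← hΦΘ k j, ← hΦΘ k' j, h])
  have hsurj : Function.Surjective Θ := by
    intro q
    -- `s m` attains every first `m` coordinates, and `Θ` is its uniform limit with closed range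
    have hk : ∀ m, ∃ k : K, H m (p m k) = initialSegment m q := by
      intro m
      obtain ⟨k, hk, hkq⟩ := ((H m).symm (initialSegment m q)).2
      refine ⟨⟨k, hk⟩, ?_⟩
      rw [← (H m).apply_symm_apply (initialSegment m q)]
      exact congrArg _ (Subtype.ext hkq)
    choose k hk using hk
    have hlim : Tendsto (fun m => Θ (k m)) atTop (𝓝 q) := by
      refine tendsto_pi_nhds.2 fun i => tendsto_subtype_rng.2 ?_
      rw [tendsto_iff_dist_tendsto_zero]
      refine squeeze_zero' (Eventually.of_forall fun _ => dist_nonneg) ?_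
        (tendsto_iff_dist_tendsto_zero.1 (hΨ i))
      filter_upwards [eventually_gt_atTop i] with m hm
      have hsq : ψ i m (k m) = (q i : ℝ) := by
        change ((extendZero (H m (p m (k m))) i : I) : ℝ) = q i
        rw [hk, extendZero_of_lt _ hm]; rfl
      rw [← hsq, dist_comm]
      exact ContinuousMap.dist_apply_le_dist (k m)
    exact (isCompact_range hΘ).isClosed.mem_of_tendsto hlim
      (Eventually.of_forall fun m => mem_range_self _)
  exact ⟨Continuous.homeoOfEquivCompactToT2 (f := Equiv.ofBijective Θ ⟨hinj, hsurj⟩) hΘ⟩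

/-! ### States and moments -/

section Translation

/-- The homeomorphism by which `g` acts, as a continuous map. -/
def smulMap {G : Type*} [Group G] [TopologicalSpace G] (Y : Type*) [TopologicalSpace Y]
    [MulAction G Y] [ContinuousSMul G Y] (g : G) : C(Y, Y) := ⟨(g • ·), continuous_const_smul g⟩

variable {Y : Type*} [TopologicalSpace Y] {G : Type*} [Group G] [TopologicalSpace G]
  [MulAction G Y] [ContinuousSMul G Y]

lemma continuous_comp_smulMap (f : C(Y, ℝ)) : Continuous fun g : G => f.comp (smulMap Y g) :=
  (ContinuousMap.curry ⟨fun p : G × Y => f (p.1 • p.2), by fun_prop⟩).continuous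

lemma comp_smulMap_comp_smulMap (f : C(Y, ℝ)) (g h : G) :
    (f.comp (smulMap Y g)).comp (smulMap Y h) = f.comp (smulMap Y (g * h)) := by
  ext y; simp [smulMap, mul_smul]

lemma comp_smulMap_one (f : C(Y, ℝ)) : f.comp (smulMap Y (1 : G)) = f := by
  ext y; simp [smulMap]

end Translation

section States

variable {Y Z : Type*} [TopologicalSpace Y] [CompactSpace Y] [TopologicalSpace Z] [CompactSpace Z]

/-- The states of `C(Y, ℝ)`, that is, the positive normalized functionals, with the weak-*
topology. By the Riesz representation theorem they are the regular Borel probability measures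
on `Y`. -/
def stateSpace (Y : Type*) [TopologicalSpace Y] [CompactSpace Y] : Set (WeakDual ℝ C(Y, ℝ)) :=
  {φ | (∀ f : C(Y, ℝ), 0 ≤ f → 0 ≤ φ f) ∧ φ 1 = 1}

lemma abs_apply_le_of_mem_stateSpace {φ : WeakDual ℝ C(Y, ℝ)} (hφ : φ ∈ stateSpace Y)
    (f : C(Y, ℝ)) : |φ f| ≤ ‖f‖ := by
  have h1 : ∀ x, |f x| ≤ ‖f‖ := f.norm_coe_le_norm
  have key : ∀ ε : ℝ, (∀ x, 0 ≤ ‖f‖ + ε * f x) → 0 ≤ ‖f‖ + ε * φ f := by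
    intro ε h
    have := hφ.1 (‖f‖ • 1 + ε • f) (fun x => by simpa using h x)
    simpa [hφ.2] using this
  have hm := key (-1) fun x => by linarith [le_abs_self (f x), h1 x]
  have hp := key 1 fun x => by linarith [neg_abs_le (f x), h1 x]
  exact abs_le.2 ⟨by linarith, by linarith⟩

lemma isCompact_stateSpace : IsCompact (stateSpace Y) := by
  refine (WeakDual.isCompact_closedBall (𝕜 := ℝ) (E := C(Y, ℝ)) 0 1).of_isClosed_subset ?_ ?_
  · have : stateSpace Y = (⋂ f : C(Y, ℝ), ⋂ _ : 0 ≤ f, {φ : WeakDual ℝ C(Y, ℝ) | 0 ≤ φ f}) ∩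
        {φ | φ 1 = 1} := by
      ext φ; simp [stateSpace]
    rw [this]
    exact (isClosed_iInter fun f => isClosed_iInter fun _ =>
      isClosed_le continuous_const (WeakDual.eval_continuous f)).inter
      (isClosed_eq (WeakDual.eval_continuous _) continuous_const)
  · intro φ hφ
    simp only [mem_preimage, mem_closedBall_zero_iff]
    refine ContinuousLinearMap.opNorm_le_bound _ zero_le_one fun f => ?_
    rw [one_mul]
    exact abs_apply_le_of_mem_stateSpace hφ f

instance : CompactSpace (stateSpace Y) := isCompact_iff_compactSpace.1 isCompact_stateSpace

lemma convex_stateSpace : Convex ℝ (stateSpace Y) := by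
  intro φ hφ ψ hψ a b ha hb hab
  refine ⟨fun f hf => ?_, ?_⟩
  · change 0 ≤ a * φ f + b * ψ f
    have := hφ.1 f hf
    have := hψ.1 f hf
    positivity
  · change a * φ 1 + b * ψ 1 = 1
    rw [hφ.2, hψ.2]; linarith

/-- Evaluation at a point, as a state. -/
noncomputable def evalState (y : Y) : stateSpace Y :=
  ⟨StrongDual.toWeakDual (ContinuousMap.evalCLM ℝ y), fun _ hf => hf y, rfl⟩

lemma evalState_apply (y : Y) (f : C(Y, ℝ)) : (evalState y).1 f = f y := rfl

/-- The push-forward of a state along a continuous map. -/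
noncomputable def mapState (h : C(Y, Z)) (φ : stateSpace Y) : stateSpace Z :=
  ⟨StrongDual.toWeakDual ((WeakDual.toStrongDual φ.1).comp
    ⟨(ContinuousMap.compRightAlgHom ℝ ℝ h).toLinearMap,
      ContinuousMap.compRightAlgHom_continuous ℝ ℝ h⟩),
    fun f hf => φ.2.1 (f.comp h) fun y => hf (h y), φ.2.2⟩

lemma mapState_apply (h : C(Y, Z)) (φ : stateSpace Y) (f : C(Z, ℝ)) :
    (mapState h φ).1 f = φ.1 (f.comp h) := rfl

variable {G : Type*} [Group G] [TopologicalSpace G] [MulAction G Y] [ContinuousSMul G Y]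

lemma continuous_apply_comp_smulMap (f : C(Y, ℝ)) :
    Continuous fun p : G × stateSpace Y => p.2.1 (f.comp (smulMap Y p.1)) := by
  refine continuous_iff_continuousAt.2 fun ⟨g₀, φ₀⟩ => ?_
  have h1 : Tendsto (fun p : G × stateSpace Y => p.2.1 (f.comp (smulMap Y g₀)))
      (𝓝 (g₀, φ₀)) (𝓝 (φ₀.1 (f.comp (smulMap Y g₀)))) :=
    ((WeakDual.eval_continuous _).comp (continuous_subtype_val.comp continuous_snd)).tendsto
      (g₀, φ₀)
  have h2 : Tendsto (fun p : G × stateSpace Y =>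
      p.2.1 (f.comp (smulMap Y p.1) - f.comp (smulMap Y g₀))) (𝓝 (g₀, φ₀)) (𝓝 0) := by
    have h3 : Tendsto (fun p : G × stateSpace Y =>
        ‖f.comp (smulMap Y p.1) - f.comp (smulMap Y g₀)‖) (𝓝 (g₀, φ₀)) (𝓝 0) := by
      have hc : Continuous fun p : G × stateSpace Y =>
          ‖f.comp (smulMap Y p.1) - f.comp (smulMap Y g₀)‖ :=
        (((continuous_comp_smulMap f).comp continuous_fst).sub continuous_const).norm
      simpa using hc.tendsto (g₀, φ₀)
    exact squeeze_zero_norm (fun p => abs_apply_le_of_mem_stateSpace p.2.2 _) h3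
  have h4 := h2.add h1
  rw [zero_add] at h4
  refine h4.congr fun p => ?_
  rw [← map_add, sub_add_cancel]

end States

lemma linearIndependent_pow_of_surjective {Y : Type*} [TopologicalSpace Y] (h : C(Y, I))
    (hh : Function.Surjective h) :
    LinearIndependent ℝ fun n : ℕ => (⟨fun y => (h y : ℝ) ^ n, by fun_prop⟩ : C(Y, ℝ)) := by
  let q : C(Y, ℝ) := ⟨fun y => (h y : ℝ), by fun_prop⟩
  have hq : ∀ p : Polynomial ℝ, ∀ y, Polynomial.aeval q p y = p.eval (h y : ℝ) := by
    intro p y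
    induction p using Polynomial.induction_on' with
    | add p₁ p₂ h₁ h₂ => simp [h₁, h₂]
    | monomial n a => simp [Polynomial.aeval_monomial, q, Algebra.algebraMap_eq_smul_one]
  have hinj : LinearMap.ker (Polynomial.aeval (R := ℝ) q).toLinearMap = ⊥ := by
    refine LinearMap.ker_eq_bot'.2 fun p hp => ?_
    refine Polynomial.eq_zero_of_infinite_isRoot p ((Icc_infinite zero_lt_one).mono fun t ht => ?_)
    obtain ⟨y, hy⟩ := hh ⟨t, ht⟩
    have := hq p y
    rw [show Polynomial.aeval q p = 0 from hp, hy] at this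
    exact this.symm
  have := (Polynomial.basisMonomials ℝ).linearIndependent.map' _ hinj
  have e : (fun n : ℕ => (⟨fun y => (h y : ℝ) ^ n, by fun_prop⟩ : C(Y, ℝ)))
      = (Polynomial.aeval (R := ℝ) q).toLinearMap ∘ Polynomial.basisMonomials ℝ := by
    ext n y
    simp [q]
  rw [e]
  exact this

/-- A countable set of vectors together with an independent sequence `u` lies in the span of a
sequence that extends `u 0` to an independent family. -/
lemma exists_linearIndependent_seq {V : Type*} [AddCommGroup V] [Module ℝ V] {u : ℕ → V}
    (hu : LinearIndependent ℝ u) {S : Set V} (hS : S.Countable) :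
    ∃ f : ℕ → V, LinearIndependent ℝ f ∧ u 0 ∉ Submodule.span ℝ (range f) ∧
      (∀ i, f i ∈ range u ∪ S) ∧
      range u ∪ S ⊆ Submodule.span ℝ (insert (u 0) (range f)) := by
  obtain ⟨b, hbt, hub, hspan, hb⟩ :=
    exists_linearIndepOn_id_extension hu.linearIndepOn_id (subset_union_left (t := S))
  have hbc : b.Countable := ((countable_range u).union hS).mono hbt
  have hbinf : (b \ {u 0}).Infinite :=
    ((infinite_range_of_injective hu.injective).mono hub).sdiff (finite_singleton _)
  have : Countable ↥(b \ {u 0}) := (hbc.mono sdiff_subset).to_subtype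
  have : Infinite ↥(b \ {u 0}) := hbinf.to_subtype
  obtain ⟨e⟩ : Nonempty (ℕ ≃ ↥(b \ {u 0})) := nonempty_equiv_of_countable
  let f : ℕ → V := fun i => (e i).1
  have hrange : range f = b \ {u 0} := by
    change range (Subtype.val ∘ e) = _
    rw [e.surjective.range_comp, Subtype.range_val]
  have hu0 : u 0 ∈ b := hub (mem_range_self 0)
  refine ⟨f, ?_, ?_, fun i => hbt (e i).2.1, ?_⟩
  · exact LinearIndependent.comp (v := fun x : b => (x : V)) hb (fun i => ⟨e i, (e i).2.1⟩)
      fun i j hij => e.injective (Subtype.ext (congrArg (fun x : b => (x : V)) hij))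
  · rw [hrange]
    simpa using hb.notMem_span hu0
  · rw [hrange, insert_sdiff_singleton, insert_eq_of_mem hu0]
    exact hspan

/-- The moments `φ ↦ (φ (f i))ᵢ` of the states with respect to a sequence of functions. -/
noncomputable def stateMoments {Y : Type*} [TopologicalSpace Y] [CompactSpace Y] (f : ℕ → C(Y, ℝ))
    (φ : stateSpace Y) : ℕ → ℝ := fun i => φ.1 (f i)

lemma continuous_stateMoments {Y : Type*} [TopologicalSpace Y] [CompactSpace Y]
    (f : ℕ → C(Y, ℝ)) : Continuous (stateMoments f) :=
  continuous_pi fun i => (WeakDual.eval_continuous (f i)).comp continuous_subtype_val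

lemma convex_range_stateMoments {Y : Type*} [TopologicalSpace Y] [CompactSpace Y]
    (f : ℕ → C(Y, ℝ)) : Convex ℝ (range (stateMoments f)) := by
  rintro _ ⟨φ, rfl⟩ _ ⟨ψ, rfl⟩ a b ha hb hab
  exact ⟨⟨a • φ.1 + b • ψ.1, convex_stateSpace φ.2 ψ.2 ha hb hab⟩, rfl⟩

/-- If the functions `f i` are linearly independent modulo constants, then no non-trivial linear
combination of moments is constant, so that the moment set is infinite-dimensional. -/
lemma interior_initialSegment_stateMoments_nonempty {Y : Type*} [TopologicalSpace Y]
    [CompactSpace Y] [Nonempty Y] {f : ℕ → C(Y, ℝ)} (hf : LinearIndependent ℝ f)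
    (h1 : (1 : C(Y, ℝ)) ∉ Submodule.span ℝ (range f)) (n : ℕ) :
    (interior (initialSegment n '' range (stateMoments f))).Nonempty := by
  set A := initialSegment n '' range (stateMoments f) with hA
  obtain ⟨y₀⟩ := ‹Nonempty Y›
  have hAconv : Convex ℝ A := (convex_range_stateMoments f).linear_image
    (LinearMap.funLeft ℝ ℝ (fun i : Fin n => (i : ℕ)))
  have hmem : ∀ y : Y, (fun i : Fin n => f i y) ∈ A := fun y => ⟨_, ⟨evalState y, rfl⟩, rfl⟩
  rw [hAconv.interior_nonempty_iff_affineSpan_eq_top,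
    AffineSubspace.affineSpan_eq_top_iff_vectorSpan_eq_top_of_nonempty _ _ _ ⟨_, hmem y₀⟩]
  by_contra hne
  -- otherwise a non-zero `ℓ` is constant on `A`, in particular on the moments of point evaluations
  obtain ⟨ℓ, hℓ, hker⟩ := Submodule.exists_le_ker_of_lt_top _ (lt_top_iff_ne_top.2 hne)
  apply hℓ
  let c : Fin n → ℝ := fun i => ℓ (Pi.single i 1)
  have hℓc : ∀ y, ℓ y = ∑ i, y i * c i := fun y => by
    rw [LinearMap.pi_apply_eq_sum_univ ℓ y]
    refine Finset.sum_congr rfl fun i _ => ?_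
    rw [smul_eq_mul]
    congr 3
    ext j; simp [Pi.single_apply, eq_comm]
  let F : C(Y, ℝ) := ∑ i, c i • f i
  have hFℓ : ∀ y, F y = ℓ (fun i : Fin n => f i y) := fun y => by
    simp [F, hℓc, ContinuousMap.sum_apply, mul_comm]
  have hFconst : ∀ y, F y = F y₀ := by
    intro y
    have := hker (vsub_mem_vectorSpan ℝ (hmem y) (hmem y₀))
    rw [LinearMap.mem_ker, vsub_eq_sub, map_sub, ← hFℓ, ← hFℓ] at this
    linarith
  have hFspan : F ∈ Submodule.span ℝ (range f) :=
    Submodule.sum_mem _ fun i _ => Submodule.smul_mem _ _ (Submodule.subset_span (mem_range_self _))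
  have hF0 : F = 0 := by
    have hF : F = F y₀ • (1 : C(Y, ℝ)) := by ext y; simp [hFconst y]
    by_cases h : F y₀ = 0
    · rw [hF, h, zero_smul]
    · refine absurd ?_ h1
      rw [hF] at hFspan
      exact (Submodule.smul_mem_iff _ h).1 hFspan
  have hc : ∀ i, c i = 0 := Fintype.linearIndependent_iff.1
    (hf.comp (fun i : Fin n => (i : ℕ)) Fin.val_injective) c hF0
  ext i
  simpa [c] using hc i

/-! ### Invariant states and invariant measures -/

/-- If every continuous action on `X` has an invariant probability measure, then so has every
continuous action on a space homeomorphic to `X`. -/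
lemma exists_smulInvariantMeasure_of_homeomorph {G : Type*} [Group G] [TopologicalSpace G]
    {X Y : Type*} [TopologicalSpace X] [MeasurableSpace X] [BorelSpace X] [TopologicalSpace Y]
    [MeasurableSpace Y] [BorelSpace Y] (e : X ≃ₜ Y)
    (hX : ∀ [MulAction G X] [ContinuousSMul G X],
      ∃ μ : Measure X, IsProbabilityMeasure μ ∧ SMulInvariantMeasure G X μ)
    [MulAction G Y] [ContinuousSMul G Y] :
    ∃ μ : Measure Y, IsProbabilityMeasure μ ∧ SMulInvariantMeasure G Y μ := by
  let _ : MulAction G X := e.toEquiv.mulAction G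
  have hsmul : ∀ (g : G) x, e (g • x) = g • e x := fun g x => e.apply_symm_apply _
  have : ContinuousSMul G X := ⟨by
    have h : Continuous fun p : G × X => e.symm (p.1 • e p.2) := by fun_prop
    exact h⟩
  obtain ⟨μ, hμ, hinv⟩ := hX
  refine ⟨μ.map e, Measure.isProbabilityMeasure_map e.continuous.aemeasurable, ⟨fun g s hs => ?_⟩⟩
  have hg : MeasurableSet ((fun y : Y => g • y) ⁻¹' s) :=
    (continuous_const_smul g).measurable hs
  rw [Measure.map_apply e.continuous.measurable hg, Measure.map_apply e.continuous.measurable hs,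
    ← hinv.measure_preimage_smul g (e.continuous.measurable hs)]
  congr 1
  ext x
  simp [hsmul]

/-- The moments of a state determine it on the closed span of the constants and the `f i`. -/
lemma apply_eq_of_stateMoments_eq {Y : Type*} [TopologicalSpace Y] [CompactSpace Y]
    {f : ℕ → C(Y, ℝ)} {φ ψ : stateSpace Y}
    (h : stateMoments f φ = stateMoments f ψ) {v : C(Y, ℝ)}
    (hv : v ∈ (Submodule.span ℝ (insert 1 (range f))).topologicalClosure) : φ.1 v = ψ.1 v := by
  have hclosed : IsClosed {v : C(Y, ℝ) | φ.1 v = ψ.1 v} :=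
    isClosed_eq (map_continuous φ.1) (map_continuous ψ.1)
  refine closure_minimal (fun w hw => ?_) hclosed hv
  refine Submodule.span_induction (p := fun w _ => φ.1 w = ψ.1 w) ?_ ?_ ?_ ?_ hw
  · rintro _ (rfl | ⟨i, rfl⟩)
    · rw [φ.2.2, ψ.2.2]
    · exact congrFun h i
  · simp
  · intro x y _ _ hx hy
    rw [map_add, map_add, hx, hy]
  · intro a x _ hx
    rw [map_smul, map_smul, hx]

section FiniteInvariance

variable {G : Type*} [Group G] [TopologicalSpace G] [TopologicalSpace.SeparableSpace G]
  {Y : Type*} [TopologicalSpace Y] [CompactSpace Y] [MulAction G Y] [ContinuousSMul G Y]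

/-- Every finite set of functions lies, together with its `G`-translates, in the closed span of
the constants and of a sequence `f` that is linearly independent modulo constants, and this closed
span contains the translates of the `f i`. The invariant independent sequence `u` makes the span
infinite-dimensional. -/
lemma exists_seq_forall_comp_smulMap_mem_closure {u : ℕ → C(Y, ℝ)} (hu : LinearIndependent ℝ u)
    (hu1 : u 0 = 1) (hinv : ∀ (g : G) n, (u n).comp (smulMap Y g) = u n)
    (F : Finset C(Y, ℝ)) :
    ∃ f : ℕ → C(Y, ℝ), LinearIndependent ℝ f ∧ 1 ∉ Submodule.span ℝ (range f) ∧
      (∀ (g : G) i, (f i).comp (smulMap Y g) ∈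
        (Submodule.span ℝ (insert 1 (range f))).topologicalClosure) ∧
      ∀ (g : G), ∀ v ∈ F, v.comp (smulMap Y g) ∈
        (Submodule.span ℝ (insert 1 (range f))).topologicalClosure := by
  let d : ℕ → G := TopologicalSpace.denseSeq G
  let S : Set C(Y, ℝ) := ⋃ v ∈ F, range fun i => v.comp (smulMap Y (d i))
  have hS : S.Countable := F.countable_toSet.biUnion fun v _ => countable_range _
  obtain ⟨f, hf, hf1, hfS, hspan⟩ := exists_linearIndependent_seq hu hS
  rw [hu1] at hf1 hspan
  have hF : ∀ (g : G), ∀ v ∈ F, v.comp (smulMap Y g) ∈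
      (Submodule.span ℝ (insert 1 (range f))).topologicalClosure := by
    intro g v hv
    have hmaps : MapsTo (fun g : G => v.comp (smulMap Y g)) (range d)
        (Submodule.span ℝ (insert 1 (range f)) : Set C(Y, ℝ)) := by
      rintro _ ⟨i, rfl⟩
      exact hspan (Or.inr (mem_biUnion hv ⟨i, rfl⟩))
    exact map_mem_closure (f := fun g : G => v.comp (smulMap Y g)) (continuous_comp_smulMap v)
      (TopologicalSpace.denseRange_denseSeq G g) hmaps
  refine ⟨f, hf, hf1, fun g i => ?_, hF⟩
  rcases hfS i with ⟨n, hn⟩ | hi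
  · rw [← hn, hinv]
    exact Submodule.le_topologicalClosure _ (hspan (Or.inl (mem_range_self n)))
  · obtain ⟨v, hv, j, hj⟩ := mem_iUnion₂.1 hi
    rw [← hj, comp_smulMap_comp_smulMap]
    exact hF _ v hv

/-- The action of `G` on the states of `C(Y, ℝ)` descends to a continuous action on the moment set,
which is a Hilbert cube by Keller's theorem; the barycentre of an invariant measure there comes
from a state with the required invariance. -/
lemma exists_state_forall_mem_finset [Nonempty Y]
    (hQ : ∀ [MulAction G HilbertCube] [ContinuousSMul G HilbertCube],
      ∃ μ : Measure HilbertCube, IsProbabilityMeasure μ ∧ SMulInvariantMeasure G HilbertCube μ)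
    {u : ℕ → C(Y, ℝ)} (hu : LinearIndependent ℝ u)
    (hu1 : u 0 = 1) (hinv : ∀ (g : G) n, (u n).comp (smulMap Y g) = u n)
    (F : Finset (G × C(Y, ℝ))) :
    ∃ φ : stateSpace Y, ∀ p ∈ F, φ.1 (p.2.comp (smulMap Y p.1)) = φ.1 p.2 := by
  classical
  obtain ⟨f, hf, hf1, hfV, hFV⟩ :=
    exists_seq_forall_comp_smulMap_mem_closure hu hu1 hinv (F.image Prod.snd)
  set V := (Submodule.span ℝ (insert 1 (range f))).topologicalClosure with hV
  have hFV' : ∀ p ∈ F, ∀ g : G, p.2.comp (smulMap Y g) ∈ V := fun p hp g =>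
    hFV g p.2 (Finset.mem_image_of_mem _ hp)
  let K : Set (ℕ → ℝ) := range (stateMoments f)
  have hK : IsCompact K := isCompact_range (continuous_stateMoments f)
  have : CompactSpace K := isCompact_iff_compactSpace.1 hK
  obtain ⟨e⟩ := nonempty_homeomorph_hilbertCube hK (convex_range_stateMoments f)
    (interior_initialSegment_stateMoments_nonempty hf hf1)
  let ev : stateSpace Y → K := rangeFactorization (stateMoments f)
  have hev : Continuous ev := (continuous_stateMoments f).subtype_mk _
  have hevs : Function.Surjective ev := rangeFactorization_surjective
  choose sec hsec using hevs
  have hwd : ∀ φ : stateSpace Y, ∀ v ∈ V, (sec (ev φ)).1 v = φ.1 v := fun φ v hv =>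
    apply_eq_of_stateMoments_eq (congrArg Subtype.val (hsec (ev φ))) hv
  have hev_ext : ∀ φ ψ : stateSpace Y, (∀ i, φ.1 (f i) = ψ.1 (f i)) → ev φ = ev ψ :=
    fun φ ψ h => Subtype.ext (funext h)
  have hact : ∀ (g : G) (φ : stateSpace Y),
      ev (mapState (smulMap Y g) (sec (ev φ))) = ev (mapState (smulMap Y g) φ) := fun g φ =>
    hev_ext _ _ fun i => hwd φ _ (hfV g i)
  -- `k ↦ sec k` picks states representing the points of `K`; by `hwd` the choice does not affect
  -- values on `V`, which is all that the action on `K` depends on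
  let _ : MulAction G K :=
    { smul := fun g k => ev (mapState (smulMap Y g) (sec k))
      one_smul := fun k => by
        refine Eq.trans (hev_ext _ (sec k) fun i => ?_) (hsec k)
        rw [mapState_apply, comp_smulMap_one]
      mul_smul := fun g h k => by
        refine Eq.trans (hev_ext _ _ fun i => ?_) (hact g (mapState (smulMap Y h) (sec k))).symm
        rw [mapState_apply, mapState_apply, mapState_apply, comp_smulMap_comp_smulMap] }
  have hsmul : ∀ (g : G) (k : K), g • k = ev (mapState (smulMap Y g) (sec k)) := fun _ _ => rfl
  have : ContinuousSMul G K := ⟨by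
    -- `id × ev` is a proper surjection, hence a quotient map
    have hq : IsQuotientMap (Prod.map (id : G → G) ev) :=
      (isProperMap_id.prodMap hev.isProperMap).isClosedMap.isQuotientMap
        (continuous_id.prodMap hev) (Function.surjective_id.prodMap fun k => ⟨_, hsec k⟩)
    refine hq.continuous_iff.2 (Continuous.subtype_mk (f := fun p : G × stateSpace Y =>
      stateMoments f (mapState (smulMap Y p.1) (sec (ev p.2)))) (continuous_pi fun i => ?_) _)
    refine (continuous_apply_comp_smulMap (G := G) (f i)).congr fun p => ?_
    exact (hwd p.2 _ (hfV p.1 i)).symm⟩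
  obtain ⟨μ, hμ, hμinv⟩ := exists_smulInvariantMeasure_of_homeomorph e.symm hQ
  have hcont : ∀ v ∈ V, Continuous fun k => (sec k).1 v := by
    intro v hv
    have hq : IsQuotientMap ev := hev.isClosedMap.isQuotientMap hev fun k => ⟨_, hsec k⟩
    refine hq.continuous_iff.2 ?_
    exact ((WeakDual.eval_continuous v).comp continuous_subtype_val).congr
      fun φ => (hwd φ v hv).symm
  let w : stateSpace Y → F → ℝ := fun φ p => φ.1 (p.1.2.comp (smulMap Y p.1.1)) - φ.1 p.1.2
  have hwc : Continuous w := continuous_pi fun p =>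
    ((WeakDual.eval_continuous _).comp continuous_subtype_val).sub
      ((WeakDual.eval_continuous _).comp continuous_subtype_val)
  have hwconv : Convex ℝ (range w) := by
    rintro _ ⟨φ, rfl⟩ _ ⟨ψ, rfl⟩ a b ha hb hab
    refine ⟨⟨a • φ.1 + b • ψ.1, convex_stateSpace φ.2 ψ.2 ha hb hab⟩, funext fun p => ?_⟩
    change (a * φ.1 _ + b * ψ.1 _) - (a * φ.1 _ + b * ψ.1 _)
      = a * (φ.1 _ - φ.1 _) + b * (ψ.1 _ - ψ.1 _)
    ring
  have hFV1 : ∀ p ∈ F, p.2 ∈ V := fun p hp => by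
    simpa only [comp_smulMap_one] using hFV' p hp 1
  have hwsec : Continuous fun k => w (sec k) := continuous_pi fun p =>
    (hcont _ (hFV' p.1 p.2 _)).sub (hcont _ (hFV1 p.1 p.2))
  have hmem : ∫ k, w (sec k) ∂μ ∈ range w :=
    hwconv.integral_mem (isCompact_range hwc).isClosed
      (Eventually.of_forall fun k => mem_range_self _)
      (hwsec.integrable_of_hasCompactSupport (HasCompactSupport.of_compactSpace _))
  have hzero : ∫ k, w (sec k) ∂μ = 0 := by
    have hint : ∀ v ∈ V, Integrable (fun k => (sec k).1 v) μ := fun v hv =>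
      (hcont v hv).integrable_of_hasCompactSupport (HasCompactSupport.of_compactSpace _)
    have hint' : ∀ p : F, Integrable (fun k => w (sec k) p) μ := fun p =>
      (hint _ (hFV' p.1 p.2 _)).sub (hint _ (hFV1 p.1 p.2))
    funext p
    rw [eval_integral hint']
    change ∫ k, ((sec k).1 (p.1.2.comp (smulMap Y p.1.1)) - (sec k).1 p.1.2) ∂μ = 0
    rw [integral_sub (hint _ (hFV' p.1 p.2 _)) (hint _ (hFV1 p.1 p.2)), sub_eq_zero,
      ← integral_smul_eq_self (μ := μ) (fun k => (sec k).1 p.1.2) (g := p.1.1)]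
    refine integral_congr_ae (Eventually.of_forall fun k => ?_)
    exact (hwd (mapState (smulMap Y p.1.1) (sec k)) p.1.2 (hFV1 p.1 p.2)).symm
  obtain ⟨φ, hφ⟩ := hmem
  refine ⟨φ, fun p hp => ?_⟩
  have := congrFun (hφ.trans hzero) ⟨p, hp⟩
  exact sub_eq_zero.1 this

end FiniteInvariance

/-- A separable group all of whose actions on the Hilbert cube have invariant probability measures
leaves a state of `C(X, ℝ)` invariant, for every compact `G`-space `X`. The product with an interval
on which `G` acts trivially makes the space of functions infinite-dimensional, and compactness of
the state space reduces the claim to finitely many functions. -/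
lemma exists_state_forall_comp_smulMap {G : Type*} [Group G] [TopologicalSpace G]
    [TopologicalSpace.SeparableSpace G]
    {X : Type*} [TopologicalSpace X] [CompactSpace X] [Nonempty X] [MulAction G X]
    [ContinuousSMul G X]
    (hQ : ∀ [MulAction G HilbertCube] [ContinuousSMul G HilbertCube],
      ∃ μ : Measure HilbertCube, IsProbabilityMeasure μ ∧ SMulInvariantMeasure G HilbertCube μ) :
    ∃ φ : stateSpace X, ∀ (g : G) (f : C(X, ℝ)), φ.1 (f.comp (smulMap X g)) = φ.1 f := by
  classical
  let _ : MulAction G (X × I) :=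
    { smul := fun g p => (g • p.1, p.2)
      one_smul := fun p => Prod.ext (one_smul G p.1) rfl
      mul_smul := fun g h p => Prod.ext (mul_smul g h p.1) rfl }
  have : ContinuousSMul G (X × I) := ⟨by
    have h : Continuous fun p : G × (X × I) => (p.1 • p.2.1, p.2.2) := by fun_prop
    exact h⟩
  let fst : C(X × I, X) := ⟨Prod.fst, continuous_fst⟩
  let snd : C(X × I, I) := ⟨Prod.snd, continuous_snd⟩
  have hu := linearIndependent_pow_of_surjective snd Prod.snd_surjective
  have hfin : ∀ F : Finset (G × C(X, ℝ)), ∃ φ : stateSpace X, ∀ p ∈ F,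
      φ.1 (p.2.comp (smulMap X p.1)) = φ.1 p.2 := by
    intro F
    obtain ⟨φ, hφ⟩ := exists_state_forall_mem_finset hQ hu (by ext p; simp)
      (fun g n => by ext p; rfl) (F.image fun p => (p.1, p.2.comp fst))
    exact ⟨mapState fst φ, fun p hp => hφ _ (Finset.mem_image_of_mem _ hp)⟩
  obtain ⟨φ, -, hφ⟩ := (isCompact_univ (X := stateSpace X)).inter_iInter_nonempty
    (fun p : G × C(X, ℝ) => {φ | φ.1 (p.2.comp (smulMap X p.1)) = φ.1 p.2})
    (fun p => isClosed_eq ((WeakDual.eval_continuous _).comp continuous_subtype_val)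
      ((WeakDual.eval_continuous _).comp continuous_subtype_val))
    (fun F => by
      obtain ⟨φ, hφ⟩ := hfin F
      exact ⟨φ, mem_univ _, mem_iInter₂.2 hφ⟩)
  exact ⟨φ, fun g f => mem_iInter.1 hφ (g, f)⟩

open scoped CompactlySupported in
/-- **Riesz representation**: an invariant state is integration against a regular invariant
probability measure. -/
lemma exists_regular_smulInvariantMeasure_of_state {G : Type*} [Group G] [TopologicalSpace G]
    {X : Type*} [TopologicalSpace X] [CompactSpace X] [T2Space X] [MeasurableSpace X]
    [BorelSpace X] [MulAction G X] [ContinuousSMul G X] (φ : stateSpace X)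
    (hφ : ∀ (g : G) (f : C(X, ℝ)), φ.1 (f.comp (smulMap X g)) = φ.1 f) :
    ∃ μ : Measure X, IsProbabilityMeasure μ ∧ μ.Regular ∧ SMulInvariantMeasure G X μ := by
  let Λ : C_c(X, ℝ) →ₚ[ℝ] ℝ := PositiveLinearMap.mk₀
    { toFun := fun f => φ.1 (f : C(X, ℝ))
      map_add' := fun f g => map_add φ.1 (f : C(X, ℝ)) (g : C(X, ℝ))
      map_smul' := fun a f => map_smul φ.1 a (f : C(X, ℝ)) }
    fun f hf => φ.2.1 f hf
  have hint : ∀ f : C(X, ℝ), ∫ x, f x ∂(RealRMK.rieszMeasure Λ) = φ.1 f := fun f =>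
    RealRMK.integral_rieszMeasure Λ (CompactlySupportedContinuousMap.continuousMapEquiv f)
  set μ := RealRMK.rieszMeasure Λ
  have hprob : IsProbabilityMeasure μ := by
    have h := hint 1
    rw [φ.2.2] at h
    simp only [ContinuousMap.one_apply, integral_const, smul_eq_mul, mul_one] at h
    exact ⟨by rwa [Measure.real, ENNReal.toReal_eq_one_iff] at h⟩
  refine ⟨μ, hprob, inferInstance, ⟨fun g s hs => ?_⟩⟩
  have hreg : (μ.map (g • ·)).Regular := Measure.Regular.map (Homeomorph.smul g)
  have hmap : μ.map (g • ·) = μ := by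
    refine Measure.ext_of_integral_eq_on_compactlySupported fun f => ?_
    have hf : AEStronglyMeasurable (fun x => f x) (μ.map (g • ·)) :=
      (map_continuous f).aestronglyMeasurable
    rw [integral_map (continuous_const_smul g).aemeasurable hf]
    exact (hint ((f : C(X, ℝ)).comp (smulMap X g))).trans ((hφ g f).trans (hint f).symm)
  rw [← Measure.map_apply (continuous_const_smul g).measurable hs, hmap]

theorem mainTheorem1 (G : Type u) [Group G] [TopologicalSpace G] [IsTopologicalGroup G]
    [PolishSpace G] :
    IsAmenableGroup.{u, v} G ↔
      ∀ [MulAction G HilbertCube] [ContinuousSMul G HilbertCube],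
        ∃ μ : Measure HilbertCube,
          IsProbabilityMeasure μ ∧ SMulInvariantMeasure G HilbertCube μ := by
  constructor
  · intro hG _ _
    -- the test spaces live in `Type v`, so the cube is replaced by its copy there
    let _ : MeasurableSpace (ULift.{v} HilbertCube) := borel _
    have : BorelSpace (ULift.{v} HilbertCube) := ⟨rfl⟩
    refine exists_smulInvariantMeasure_of_homeomorph
      (Homeomorph.ulift : ULift.{v} HilbertCube ≃ₜ HilbertCube) ?_
    intro _ _
    obtain ⟨μ, hμ, -, hinv⟩ := hG (ULift.{v} HilbertCube)
    exact ⟨μ, hμ, hinv⟩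
  · intro hQ X _ _ _ _ _ _ _ _
    obtain ⟨φ, hφ⟩ := exists_state_forall_comp_smulMap (G := G) (X := X) hQ
    exact exists_regular_smulInvariantMeasure_of_state φ hφ
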